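/- **Setting.** A routing problem $G$ consists of a finite directed graph $(V,E)$ (parallel edges allowed), a non-negative non-decreasing latency function $\ell_e:\mathbb{R}_{\ge 0}\to\mathbb{R}_{\ge 0}$ for each edge $e$, and finitely many origin-destination pairs $(o_i,d_i)$, each joined by a non-empty set $\mathcal{P}_i$ of simple paths and carrying a mass $r_i\ge 0$ of infinitesimal users. A feasible flow $f$ distributes, for each $i$, the mass $r_i$ over the paths in $\mathcal{P}_i$; $f_e$ denotes the resulting total mass on edge $e$, and $\mathcal{L}(f)=\sum_{e\in E} f_e\,\ell_e(f_e)$ is the total latency. Given incentive functions $\tau_e:\mathbb{R}_{\ge 0}\to\mathbb{R}$, a feasible flow is a Nash flow if, for each $i$, every path of $\mathcal{P}_i$ carrying positive mass of pair $i$ minimizes $P\mapsto\sum_{e\in P}\bigl(\ell_e(f_e)+\tau_e(f_e)\bigr)$ over $\mathcal{P}_i$ (users are homogeneous). For a family $\mathcal{G}$ of routing problems, a network-agnostic incentive mechanism $T$ assigns to each edge of each problem in $\mathcal{G}$ an incentive function $\tau_e=T(\ell_e)$ (integrable on bounded intervals) that depends only on the latency function $\ell_e$. Its price of anarchy is $$\mathrm{PoA}(\mathcal{G},T)=\sup_{G\in\mathcal{G}}\frac{\sup\{\mathcal{L}(f):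 f\text{ a Nash flow of }G\text{ under }T\}}{\inf\{\mathcal{L}(f): f\text{ a feasible flow of }G\}}$$ (with $0/0=0$, $c/0=\infty$ for $c>0$, and the supremum over an empty set of Nash flows equal to $0$). For $\beta\ge 0$, $T$ is a toll bounded by $\beta$ if $T(\ell_e)[x]\in[0,\beta\,\ell_e(x)]$ for all edges and all $x\ge 0$, and a subsidy bounded by $\beta$ if $T(\ell_e)[x]\in[-\beta\,\ell_e(x),0]$. A bounded network-agnostic toll (subsidy) is optimal if it minimizes $\mathrm{PoA}(\mathcal{G},\cdot)$ among all network-agnostic tolls (subsidies) bounded by $\beta$. Let $\mathcal{G}^{\rm aff}$ be the family of all routing problems in which each latency function has the form $\ell_e(x)=a_e x+b_e$ with $a_e,b_e\ge 0$. **Proposition.** Let $\beta\ge 0$. (1) The mechanism $$T^{\rm opt+}(ax+b;\beta)=\begin{cases}\beta a x,&\beta\in[0,1),\\ a x,&\beta\ge 1,\end{cases}$$ is an optimal network-agnostic toll bounded by $\beta$ in $\mathcal{G}^{\rm aff}$, and $$\mathrm{PoA}(\mathcal{G}^{\rm aff},T^{\rm opt+}(\beta))=\begin{cases}\dfrac{4}{3+2\beta-\beta^2},&\beta\in[0,1),\\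 1,&\beta\ge 1.\end{cases}$$ (2) The mechanism $$T^{\rm opt-}(ax+b;\beta)=\begin{cases}-\beta b,&\beta\in[0,1/2),\\ -b/2,&\beta\ge 1/2,\end{cases}$$ is an optimal network-agnostic subsidy bounded by $\beta$ in $\mathcal{G}^{\rm aff}$, and $$\mathrm{PoA}(\mathcal{G}^{\rm aff},T^{\rm opt-}(\beta))=\begin{cases}\dfrac{4}{3+2\hat\beta-\hat\beta^2},&\beta\in[0,1/2),\\ 1,&\beta\ge 1/2,\end{cases}\qquad \hat\beta=\frac{1}{1-\beta}-1.$$ (3) For every $\beta\in(0,1)$, every optimal network-agnostic toll $T^+$ bounded by $\beta$ and every optimal network-agnostic subsidy $T^-$ bounded by $\beta$ satisfy $$\mathrm{PoA}(\mathcal{G}^{\rm aff},T^+)>\mathrm{PoA}(\mathcal{G}^{\rm aff},T^-).$$ -/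

import Mathlib

open scoped NNReal ENNReal

noncomputable section

namespace CongestionGame

/-- `IsWalk src tgt u p v`: the list `p` of consecutive directed edges leads from `u` to `v`. -/
def IsWalk {V E : Type} (src tgt : E → V) : V → List E → V → Prop
  | u, [], v => u = v
  | u, e :: p, v => src e = u ∧ IsWalk src tgt (tgt e) p v

/-- A simple path from `u` to `v`: a walk that visits no vertex twice. -/
def IsSimplePath {V E : Type} (src tgt : E → V) (u : V) (p : List E) (v : V) : Prop :=
  IsWalk src tgt u p v ∧ (u :: p.map tgt).Nodup

/-- A (non-atomic) routing problem: a finite directed graph (parallel edges allowed), a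
non-negative non-decreasing latency function on each edge, and finitely many
origin-destination pairs, each joined by at least one path and carrying a mass of traffic. -/
structure RoutingProblem where
  /-- vertices -/
  V : Type
  /-- edges -/
  E : Type
  [fintypeV : Fintype V]
  [fintypeE : Fintype E]
  /-- tail of an edge -/
  src : E → V
  /-- head of an edge -/
  tgt : E → V
  /-- latency functions -/
  lat : E → ℝ≥0 → ℝ≥0
  lat_mono : ∀ e, Monotone (lat e)
  /-- number of origin-destination pairs -/
  k : ℕ
  /-- origins -/
  orig : Fin k → V
  /-- destinations -/
  dest : Fin k → V
  /-- masses of traffic -/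
  rate : Fin k → ℝ≥0
  exists_path : ∀ i, ∃ p, IsSimplePath src tgt (orig i) p (dest i)

attribute [instance] RoutingProblem.fintypeV RoutingProblem.fintypeE

namespace RoutingProblem

variable (G : RoutingProblem)

/-- The set of simple paths from the `i`-th origin to the `i`-th destination. -/
abbrev Path (i : Fin G.k) : Type :=
  {p : List G.E // IsSimplePath G.src G.tgt (G.orig i) p (G.dest i)}

instance (i : Fin G.k) : Finite (G.Path i) := by
  classical
  have h : ∀ p : G.Path i, p.1.Nodup := fun p =>
    List.Nodup.of_map G.tgt (List.nodup_cons.1 p.2.2).2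
  exact Finite.of_injective (β := {l : List G.E // l.Nodup}) (fun p => ⟨p.1, h p⟩)
    (fun p q hpq => Subtype.ext (Subtype.mk.inj hpq))

instance (i : Fin G.k) : Fintype (G.Path i) := Fintype.ofFinite _

/-- A flow: the mass of traffic of each origin-destination pair on each of its paths. -/
abbrev Flow : Type := (i : Fin G.k) → G.Path i → ℝ≥0

/-- A flow is feasible if it routes exactly the mass `rate i` of each pair `i`. -/
def Feasible (f : G.Flow) : Prop := ∀ i, ∑ p, f i p = G.rate i

open Classical in
/-- The mass of traffic on the edge `e`. -/
def edgeFlow (f : G.Flow) (e : G.E) : ℝ≥0 :=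
  ∑ i, ∑ p : G.Path i, if e ∈ p.1 then f i p else 0

/-- The total latency of a flow. -/
def totalLatency (f : G.Flow) : ℝ≥0 :=
  ∑ e, G.edgeFlow f e * G.lat e (G.edgeFlow f e)

/-- The cost observed on the path `p` in the flow `f` under the incentives `τ`
(users are homogeneous, with unit sensitivity to incentives). -/
def pathCost (τ : G.E → ℝ≥0 → ℝ) (f : G.Flow) (p : List G.E) : ℝ :=
  (p.map fun e => (G.lat e (G.edgeFlow f e) : ℝ) + τ e (G.edgeFlow f e)).sum

/-- A Nash flow: a feasible flow in which every path in use has minimal observed cost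
among the paths of its origin-destination pair. -/
def IsNash (τ : G.E → ℝ≥0 → ℝ) (f : G.Flow) : Prop :=
  G.Feasible f ∧
    ∀ (i : Fin G.k) (p : G.Path i), 0 < f i p →
      ∀ q : G.Path i, G.pathCost τ f p.1 ≤ G.pathCost τ f q.1

/-- The highest total latency of a Nash flow. -/
def nashLatency (τ : G.E → ℝ≥0 → ℝ) : ℝ≥0∞ :=
  ⨆ (f : G.Flow) (_ : G.IsNash τ f), (G.totalLatency f : ℝ≥0∞)

/-- The total latency of an optimal flow. -/
def optLatency : ℝ≥0∞ :=
  ⨅ (f : G.Flow) (_ : G.Feasible f), (G.totalLatency f : ℝ≥0∞)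

end RoutingProblem

/-- An incentive mechanism assigns an incentive function to every edge of every routing problem;
in general it may depend on the whole problem. -/
abbrev Mechanism : Type 1 := (G : RoutingProblem) → G.E → ℝ≥0 → ℝ

/-- The price of anarchy of a family `𝒢` of routing problems under the mechanism `T`. -/
def poa (𝒢 : Set RoutingProblem) (T : Mechanism) : ℝ≥0∞ :=
  ⨆ G ∈ 𝒢, G.nashLatency (T G) / G.optLatency

/-- On the family `𝒢`, edges with the same latency function get the same incentive function. -/
def IsNetworkAgnostic (𝒢 : Set RoutingProblem) (T : Mechanism) : Prop :=
  ∀ G ∈ 𝒢, ∀ G' ∈ 𝒢, ∀ (e : G.E) (e' : G'.E), G.lat e = G'.lat e' → T G e = T G' e'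

/-- (Local) integrability of an incentive function on the half-line `[0, ∞)`. -/
def IsIntegrableIncentive (τ : ℝ≥0 → ℝ) : Prop :=
  MeasureTheory.LocallyIntegrableOn (fun x : ℝ => τ x.toNNReal) (Set.Ici 0) MeasureTheory.volume

/-- The network-agnostic tolling mechanisms on `𝒢` that are bounded by `β`:
`τ_e(x) ∈ [0, β ℓ_e(x)]`. -/
def boundedTolls (𝒢 : Set RoutingProblem) (β : ℝ) : Set Mechanism :=
  {T | IsNetworkAgnostic 𝒢 T ∧ ∀ G ∈ 𝒢, ∀ e : G.E, IsIntegrableIncentive (T G e) ∧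
    ∀ x, T G e x ∈ Set.Icc 0 (β * G.lat e x)}

/-- The network-agnostic subsidy mechanisms on `𝒢` that are bounded by `β`:
`τ_e(x) ∈ [-β ℓ_e(x), 0]`. -/
def boundedSubsidies (𝒢 : Set RoutingProblem) (β : ℝ) : Set Mechanism :=
  {T | IsNetworkAgnostic 𝒢 T ∧ ∀ G ∈ 𝒢, ∀ e : G.E, IsIntegrableIncentive (T G e) ∧
    ∀ x, T G e x ∈ Set.Icc (-(β * G.lat e x)) 0}

/-- `T` minimizes the price of anarchy of `𝒢` over the set `S` of mechanisms. -/
def IsOptimal (𝒢 : Set RoutingProblem) (S : Set Mechanism) (T : Mechanism) : Prop :=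
  T ∈ S ∧ ∀ T' ∈ S, poa 𝒢 T ≤ poa 𝒢 T'

/-- Affine congestion games: every latency function is `x ↦ a x + b` with `a, b ≥ 0`. -/
def affineGames : Set RoutingProblem :=
  {G | ∀ e : G.E, ∃ a b : ℝ≥0, ∀ x, G.lat e x = a * x + b}

/-- The mechanism that assigns to the latency function `a x + b` the incentive
`k₁ a x + k₂ b`; see `affineMechanism_apply`. -/
def affineMechanism (k₁ k₂ : ℝ) : Mechanism := fun G e x =>
  k₁ * ((G.lat e x : ℝ) - G.lat e 0) + k₂ * G.lat e 0

theorem affineMechanism_apply (k₁ k₂ : ℝ) (G : RoutingProblem) (e : G.E) (a b : ℝ≥0)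
    (h : ∀ x, G.lat e x = a * x + b) (x : ℝ≥0) :
    affineMechanism k₁ k₂ G e x = k₁ * (a * x) + k₂ * b := by
  simp [affineMechanism, h]

end CongestionGame

end

/-!
Summed over the edges, the Nash condition is a variational inequality, so an inequality between
latencies and observed costs that holds edge by edge (smoothness) bounds the price of anarchy.
For affine latencies, only the factor `γ` by which the incentives scale the slope relative to the
constant term matters: completing the square gives the bound `4 / (γ (4 - γ))`, which Pigou's
network with latencies `x` and `γ` attains. This value decreases on `(0, 2]` and equals `1` at
`γ = 2`. Below `2`, a toll bounded by `β` reaches at most `γ = 1 + β`, and a subsidy at most the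
larger `γ = 1 / (1 - β)`; Pigou's network alone shows that no incentive within the same bounds,
even one that depends on the network, does better.
-/

namespace CongestionGame

theorem sum_map_eq_sum_ite_mem {ι M : Type*} [Fintype ι] [DecidableEq ι] [AddCommMonoid M]
    {l : List ι} (hl : l.Nodup) (c : ι → M) :
    (l.map c).sum = ∑ i, if i ∈ l then c i else 0 := by
  simp [← List.sum_toFinset c hl, ← List.mem_toFinset]

theorem sum_mul_le_sum_mul_of_support_minimizes {ι : Type*} [Fintype ι] {u v c : ι → ℝ}
    (hu : ∀ i, 0 ≤ u i) (hv : ∀ i, 0 ≤ v i) (huv : ∑ i, u i = ∑ i, v i)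
    (hmin : ∀ i, 0 < u i → ∀ j, c i ≤ c j) :
    ∑ i, u i * c i ≤ ∑ i, v i * c i := by
  rcases isEmpty_or_nonempty ι with _ | _
  · simp
  obtain ⟨m, hm⟩ := Finite.exists_min c
  calc ∑ i, u i * c i
      ≤ ∑ i, u i * c m := by
        refine Finset.sum_le_sum fun i _ => ?_
        rcases (hu i).eq_or_lt with hi | hi
        · simp [← hi]
        · exact mul_le_mul_of_nonneg_left (hmin i hi m) hi.le
    _ = ∑ i, v i * c m := by rw [← Finset.sum_mul, huv, Finset.sum_mul]
    _ ≤ ∑ i, v i * c i :=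
        Finset.sum_le_sum fun i _ => mul_le_mul_of_nonneg_left (hm i) (hv i)

theorem IsSimplePath.nodup {V E : Type} {src tgt : E → V} {u v : V} {p : List E}
    (hp : IsSimplePath src tgt u p v) : p.Nodup :=
  List.Nodup.of_map tgt (List.nodup_cons.1 hp.2).2

namespace RoutingProblem

variable {G : RoutingProblem}

theorem sum_edgeFlow_mul (f : G.Flow) (c : G.E → ℝ) :
    ∑ e, (G.edgeFlow f e : ℝ) * c e = ∑ i, ∑ p : G.Path i, (f i p : ℝ) * (p.1.map c).sum := by
  classical
  have hedge (e : G.E) : (G.edgeFlow f e : ℝ) * c e =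
      ∑ i, ∑ p : G.Path i, (f i p : ℝ) * if e ∈ p.1 then c e else 0 := by
    simp [edgeFlow, NNReal.coe_sum, Finset.sum_mul, apply_ite NNReal.toReal]
  have hpath (i : Fin G.k) (p : G.Path i) : (p.1.map c).sum = ∑ e, if e ∈ p.1 then c e else 0 :=
    sum_map_eq_sum_ite_mem p.2.nodup c
  simp only [hedge, hpath, Finset.mul_sum]
  rw [Finset.sum_comm]
  exact Finset.sum_congr rfl fun i _ => Finset.sum_comm

theorem IsNash.variational_inequality {τ : G.E → ℝ≥0 → ℝ} {f g : G.Flow}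
    (hf : G.IsNash τ f) (hg : G.Feasible g) :
    ∑ e, (G.edgeFlow f e : ℝ) * (G.lat e (G.edgeFlow f e) + τ e (G.edgeFlow f e)) ≤
      ∑ e, (G.edgeFlow g e : ℝ) * (G.lat e (G.edgeFlow f e) + τ e (G.edgeFlow f e)) := by
  rw [sum_edgeFlow_mul, sum_edgeFlow_mul]
  refine Finset.sum_le_sum fun i _ =>
    sum_mul_le_sum_mul_of_support_minimizes (fun p => (f i p).coe_nonneg)
      (fun p => (g i p).coe_nonneg) ?_ (hf.2 i)
  exact_mod_cast (hf.1 i).trans (hg i).symm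

theorem IsNash.totalLatency_le_of_smooth {τ : G.E → ℝ≥0 → ℝ} {f g : G.Flow} {C μ : ℝ}
    (hf : G.IsNash τ f) (hg : G.Feasible g) (hμ : 0 ≤ μ)
    (h : ∀ e (x y : ℝ≥0), x * G.lat e x + μ * ((y - x) * (G.lat e x + τ e x)) ≤
      C * (y * G.lat e y)) :
    (G.totalLatency f : ℝ) ≤ C * G.totalLatency g := by
  have hvar : 0 ≤ μ * ∑ e, ((G.edgeFlow g e : ℝ) - G.edgeFlow f e) *
      (G.lat e (G.edgeFlow f e) + τ e (G.edgeFlow f e)) := by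
    simp only [sub_mul, Finset.sum_sub_distrib]
    exact mul_nonneg hμ (sub_nonneg.2 (hf.variational_inequality hg))
  have hsum := Finset.sum_le_sum fun e (_ : e ∈ Finset.univ) =>
    h e (G.edgeFlow f e) (G.edgeFlow g e)
  rw [Finset.sum_add_distrib, ← Finset.mul_sum, ← Finset.mul_sum] at hsum
  simp only [totalLatency, NNReal.coe_sum, NNReal.coe_mul]
  linarith

-- Stated for a variable `G`, since on a concrete problem `G.Path i` unfolds and its `Fintype`
-- instance is no longer found.
theorem sum_path_eq_sum {ι M : Type*} [Fintype ι] [AddCommMonoid M] {i : Fin G.k}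
    (φ : ι ≃ G.Path i) (F : G.Path i → M) : ∑ p, F p = ∑ j, F (φ j) :=
  (φ.sum_comp F).symm

end RoutingProblem

section PriceOfAnarchy

variable {𝒢 : Set RoutingProblem} {T : Mechanism}

theorem poa_le_of_forall_isNash {C : ℝ} (hC : 0 < C)
    (h : ∀ G ∈ 𝒢, ∀ f g : G.Flow, G.IsNash (T G) f → G.Feasible g →
      (G.totalLatency f : ℝ) ≤ C * G.totalLatency g) :
    poa 𝒢 T ≤ ENNReal.ofReal C := by
  refine iSup₂_le fun G hG => ENNReal.div_le_of_le_mul (iSup₂_le fun f hf => ?_)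
  have hC₀ : ENNReal.ofReal C ≠ 0 := (ENNReal.ofReal_pos.2 hC).ne'
  simp only [RoutingProblem.optLatency, ENNReal.mul_iInf_of_ne hC₀ ENNReal.ofReal_ne_top]
  refine le_iInf₂ fun g hg => ?_
  rw [← ENNReal.ofReal_coe_nnreal, ← ENNReal.ofReal_coe_nnreal, ← ENNReal.ofReal_mul hC.le]
  exact ENNReal.ofReal_le_ofReal (h G hG f g hf hg)

theorem totalLatency_div_le_poa {G : RoutingProblem} (hG : G ∈ 𝒢) {f g : G.Flow}
    (hf : G.IsNash (T G) f) (hg : G.Feasible g) :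
    (G.totalLatency f : ℝ≥0∞) / G.totalLatency g ≤ poa 𝒢 T :=
  (ENNReal.div_le_div (le_iSup₂_of_le f hf le_rfl) (iInf₂_le g hg)).trans
    (le_iSup₂ (f := fun G (_ : G ∈ 𝒢) => G.nashLatency (T G) / G.optLatency) G hG)

end PriceOfAnarchy

/-- The ratio `1 / (γ (4 - γ) / 4)` of the Nash latency to the optimal latency in Pigou's network
with latencies `x` and `γ`; it is the price of anarchy on affine games of an incentive that scales
the slope by `γ` relative to the constant term. Meaningful for `0 < γ ≤ 2`. -/
noncomputable def pigouRatio (γ : ℝ) : ℝ := 4 / (γ * (4 - γ))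

theorem pigouRatio_two : pigouRatio 2 = 1 := by norm_num [pigouRatio]

theorem pigouRatio_one_add (t : ℝ) : pigouRatio (1 + t) = 4 / (3 + 2 * t - t ^ 2) := by
  rw [pigouRatio]
  congr 1
  ring

theorem strictAntiOn_pigouRatio : StrictAntiOn pigouRatio (Set.Ioc 0 2) := by
  rintro s ⟨hs, -⟩ t ⟨-, ht⟩ hst
  refine div_lt_div_of_pos_left four_pos (mul_pos hs (by linarith)) ?_
  nlinarith

theorem one_le_pigouRatio {γ : ℝ} (hγ : γ ∈ Set.Ioc 0 2) : 1 ≤ pigouRatio γ :=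
  pigouRatio_two ▸ strictAntiOn_pigouRatio.antitoneOn hγ (by norm_num) hγ.2

theorem pigouRatio_mul {γ : ℝ} (hγ : γ ∈ Set.Ioc 0 2) : pigouRatio γ * (γ * (4 - γ)) = 4 :=
  div_mul_cancel₀ _ (mul_pos hγ.1 (by linarith [hγ.2])).ne'

theorem one_div_one_sub_mem_Ioc {k : ℝ} (hk : k ≤ 1 / 2) : 1 / (1 - k) ∈ Set.Ioc (0 : ℝ) 2 :=
  have hpos : 0 < 1 - k := by linarith
  ⟨by positivity, (div_le_iff₀ hpos).2 (by linarith)⟩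

theorem pigouRatio_one_div_one_sub_min_lt {β : ℝ} (hβ₀ : 0 < β) (hβ₁ : β < 1) :
    pigouRatio (1 / (1 - min β (1 / 2))) < pigouRatio (1 + β) := by
  have hmin : min β (1 / 2) ≤ 1 / 2 := min_le_right _ _
  refine strictAntiOn_pigouRatio ⟨by linarith, by linarith⟩ (one_div_one_sub_mem_Ioc hmin)
    ((lt_div_iff₀ (by linarith)).2 ?_)
  rcases min_cases β (1 / 2) with ⟨h, -⟩ | ⟨h, -⟩ <;> rw [h] <;> nlinarith

theorem affine_smoothness {γ a b x : ℝ} (hγ : γ ∈ Set.Ioc 0 2) (ha : 0 ≤ a) (hb : 0 ≤ b)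
    (hx : 0 ≤ x) (y : ℝ) :
    x * (a * x + b) + pigouRatio γ * ((y - x) * (γ * (a * x) + b)) ≤
      pigouRatio γ * (y * (a * y + b)) := by
  have hC := one_le_pigouRatio hγ
  have hsquare : 0 ≤ a * (pigouRatio γ * (y - γ * x / 2) ^ 2) := by positivity
  have hconst : 0 ≤ (pigouRatio γ - 1) * (b * x) := mul_nonneg (by linarith) (by positivity)
  linear_combination hsquare + hconst - (a * x ^ 2 / 4) * pigouRatio_mul hγ

theorem poa_affineMechanism_le {γ k₁ k₂ : ℝ} (hγ : γ ∈ Set.Ioc 0 2) (hk₂ : -1 < k₂)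
    (hk : 1 + k₁ = γ * (1 + k₂)) :
    poa affineGames (affineMechanism k₁ k₂) ≤ ENNReal.ofReal (pigouRatio γ) := by
  have hpos : 0 < 1 + k₂ := by linarith
  have hC : 0 < pigouRatio γ := zero_lt_one.trans_le (one_le_pigouRatio hγ)
  refine poa_le_of_forall_isNash hC fun G hG f g hf hg =>
    hf.totalLatency_le_of_smooth hg (div_pos hC hpos).le fun e x y => ?_
  obtain ⟨a, b, hab⟩ := hG e
  have hcost : (G.lat e x : ℝ) + affineMechanism k₁ k₂ G e x = (1 + k₂) * (γ * (a * x) + b) := by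
    rw [affineMechanism_apply k₁ k₂ G e a b hab, hab]
    push_cast
    linear_combination (a * x : ℝ) * hk
  have hscale : pigouRatio γ / (1 + k₂) * ((y - x) * ((1 + k₂) * (γ * (a * x) + b))) =
      pigouRatio γ * ((y - x) * (γ * (a * x) + b)) := by
    field_simp
  rw [hcost, hscale, hab, hab]
  push_cast
  exact affine_smoothness hγ a.coe_nonneg b.coe_nonneg x.coe_nonneg y

section ParallelLinks

variable {E : Type} [Fintype E] [Nonempty E]

/-- A mass `r` of traffic from one vertex (`false`) to another (`true`) across parallel links. -/
abbrev parallelLinks (lat : E → ℝ≥0 → ℝ≥0) (hlat : ∀ e, Monotone (lat e)) (r : ℝ≥0) :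
    RoutingProblem where
  V := Bool
  E := E
  src _ := false
  tgt _ := true
  lat := lat
  lat_mono := hlat
  k := 1
  orig _ := false
  dest _ := true
  rate _ := r
  exists_path _ := ⟨[Classical.arbitrary E], by simp [IsSimplePath, IsWalk]⟩

variable (lat : E → ℝ≥0 → ℝ≥0) (hlat : ∀ e, Monotone (lat e)) (r : ℝ≥0)

/-- The paths across parallel links are the links. -/
noncomputable def linkEquivPath (i : Fin (parallelLinks lat hlat r).k) :
    E ≃ (parallelLinks lat hlat r).Path i :=
  Equiv.ofBijective (fun e => ⟨[e], by simp [IsSimplePath, IsWalk]⟩) <| by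
    constructor
    · intro e e' h
      exact (List.cons.inj (congrArg Subtype.val h)).1
    · rintro ⟨_ | ⟨e, _ | ⟨e', p⟩⟩, hwalk, hnodup⟩
      · simp [IsWalk] at hwalk
      · exact ⟨e, rfl⟩
      · simp at hnodup

/-- The flow that puts the mass `w e` on the link `e`. -/
noncomputable def linkFlow (w : E → ℝ≥0) : (parallelLinks lat hlat r).Flow :=
  fun i p => w ((linkEquivPath lat hlat r i).symm p)

variable {lat hlat r} {w : E → ℝ≥0}

@[simp]
theorem coe_linkEquivPath (i : Fin (parallelLinks lat hlat r).k) (e : E) :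
    (linkEquivPath lat hlat r i e).1 = [e] := rfl

theorem feasible_linkFlow (hw : ∑ e, w e = r) :
    (parallelLinks lat hlat r).Feasible (linkFlow lat hlat r w) := fun i =>
  (RoutingProblem.sum_path_eq_sum (linkEquivPath lat hlat r i) _).trans (by simpa [linkFlow])

theorem edgeFlow_linkFlow (e : E) :
    (parallelLinks lat hlat r).edgeFlow (linkFlow lat hlat r w) e = w e := by
  classical
  simp only [RoutingProblem.edgeFlow, Fin.sum_univ_one]
  refine (RoutingProblem.sum_path_eq_sum (linkEquivPath lat hlat r 0) _).trans ?_
  simp [linkFlow]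

theorem totalLatency_linkFlow :
    (parallelLinks lat hlat r).totalLatency (linkFlow lat hlat r w) = ∑ e, w e * lat e (w e) := by
  simp only [RoutingProblem.totalLatency, edgeFlow_linkFlow]

theorem isNash_linkFlow {τ : E → ℝ≥0 → ℝ} (hw : ∑ e, w e = r)
    (h : ∀ e, 0 < w e → ∀ e', (lat e (w e) : ℝ) + τ e (w e) ≤ lat e' (w e') + τ e' (w e')) :
    (parallelLinks lat hlat r).IsNash τ (linkFlow lat hlat r w) := by
  refine ⟨feasible_linkFlow hw, fun i p hp q => ?_⟩
  obtain ⟨e, rfl⟩ := (linkEquivPath lat hlat r i).surjective p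
  obtain ⟨e', rfl⟩ := (linkEquivPath lat hlat r i).surjective q
  have he : 0 < w e := by simpa [linkFlow] using hp
  simpa [RoutingProblem.pathCost, edgeFlow_linkFlow] using h e he e'

end ParallelLinks

theorem one_le_poa_affineGames (T : Mechanism) : 1 ≤ poa affineGames T := by
  let G := parallelLinks (E := Unit) (fun _ _ => 1) (fun _ => monotone_const) 1
  have hG : G ∈ affineGames := fun _ => ⟨0, 1, fun x => by simp [G]⟩
  have hnash : G.IsNash (T G) (linkFlow _ _ _ fun _ => 1) :=
    isNash_linkFlow (by simp) fun _ _ _ => le_rfl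
  simpa [G, totalLatency_linkFlow] using totalLatency_div_le_poa hG hnash hnash.1

/-- The latency functions of Pigou's network: `x` on the link `false` and the constant `γ` on the
link `true`. -/
def pigouLatency (γ : ℝ≥0) : Bool → ℝ≥0 → ℝ≥0
  | false => id
  | true => fun _ => γ

theorem monotone_pigouLatency (γ : ℝ≥0) : ∀ e, Monotone (pigouLatency γ e)
  | false => monotone_id
  | true => monotone_const

/-- Pigou's network with latencies `x` and `γ`, carrying a unit mass of traffic. It provides the
lower bounds on the price of anarchy. -/
abbrev pigou (γ : ℝ≥0) : RoutingProblem :=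
  parallelLinks (pigouLatency γ) (monotone_pigouLatency γ) 1

theorem pigou_mem_affineGames (γ : ℝ≥0) : pigou γ ∈ affineGames
  | false => ⟨1, 0, fun x => by simp [pigouLatency]⟩
  | true => ⟨0, γ, fun x => by simp [pigouLatency]⟩

/-- The flow in Pigou's network with mass `x` on the link of latency `x` and the rest on the link
of constant latency; feasible when `x ≤ 1` (the subtraction is truncated). -/
noncomputable def pigouFlow (γ x : ℝ≥0) : (pigou γ).Flow :=
  linkFlow _ _ _ fun e => bif e then 1 - x else x

theorem feasible_pigouFlow (γ : ℝ≥0) {x : ℝ≥0} (hx : x ≤ 1) :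
    (pigou γ).Feasible (pigouFlow γ x) :=
  feasible_linkFlow (by simp [tsub_add_cancel_of_le hx])

theorem totalLatency_pigouFlow (γ x : ℝ≥0) :
    (pigou γ).totalLatency (pigouFlow γ x) = (1 - x) * γ + x * x := by
  simp [pigouFlow, totalLatency_linkFlow, pigouLatency]

theorem isNash_pigouFlow_one {γ : ℝ≥0} {τ : Bool → ℝ≥0 → ℝ} (h : 1 + τ false 1 ≤ γ + τ true 0) :
    (pigou γ).IsNash τ (pigouFlow γ 1) := by
  refine isNash_linkFlow (by simp) ?_
  simpa [pigouLatency] using h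

theorem pigouRatio_le_poa {T : Mechanism} {γ : ℝ≥0} (hγ : (γ : ℝ) ∈ Set.Ioc 0 2)
    (h : 1 + T (pigou γ) false 1 ≤ γ + T (pigou γ) true 0) :
    ENNReal.ofReal (pigouRatio γ) ≤ poa affineGames T := by
  have hhalf : γ / 2 ≤ 1 := div_le_one_of_le₀ (by exact_mod_cast hγ.2) zero_le_two
  have hnash : (pigou γ).totalLatency (pigouFlow γ 1) = 1 := by simp [totalLatency_pigouFlow]
  -- The optimal flow equalizes the marginal latencies `2 x` and `γ` of the two links.
  have hopt : ((pigou γ).totalLatency (pigouFlow γ (γ / 2)) : ℝ) = γ * (4 - γ) / 4 := by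
    rw [totalLatency_pigouFlow]
    push_cast [NNReal.coe_sub hhalf]
    ring
  have hpos : (0 : ℝ) < γ * (4 - γ) / 4 := by
    have := mul_pos hγ.1 (by linarith [hγ.2] : (0 : ℝ) < 4 - γ)
    positivity
  calc ENNReal.ofReal (pigouRatio γ)
      = (pigou γ).totalLatency (pigouFlow γ 1) /
          (pigou γ).totalLatency (pigouFlow γ (γ / 2)) := by
        rw [hnash, ← ENNReal.ofReal_coe_nnreal (p := RoutingProblem.totalLatency _ _), hopt,
          ENNReal.coe_one, ← ENNReal.ofReal_one, ← ENNReal.ofReal_div_of_pos hpos, one_div_div,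
          pigouRatio]
    _ ≤ poa affineGames T :=
        totalLatency_div_le_poa (pigou_mem_affineGames γ) (isNash_pigouFlow_one h)
          (feasible_pigouFlow γ hhalf)

theorem poa_affineMechanism {γ k₁ k₂ : ℝ} (hγ : γ ∈ Set.Ioc 0 2) (hk₂ : -1 < k₂)
    (hk : 1 + k₁ = γ * (1 + k₂)) :
    poa affineGames (affineMechanism k₁ k₂) = ENNReal.ofReal (pigouRatio γ) := by
  refine (poa_affineMechanism_le hγ hk₂ hk).antisymm ?_
  lift γ to ℝ≥0 using hγ.1.le
  refine pigouRatio_le_poa hγ (le_of_eq ?_)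
  simp only [affineMechanism, pigouLatency, id_eq]
  push_cast
  linear_combination hk

theorem poa_affineMechanism_eq_one {k₁ k₂ : ℝ} (hk₂ : -1 < k₂) (hk : 1 + k₁ = 2 * (1 + k₂)) :
    poa affineGames (affineMechanism k₁ k₂) = 1 := by
  rw [poa_affineMechanism (by norm_num) hk₂ hk, pigouRatio_two, ENNReal.ofReal_one]

theorem poa_affineMechanism_zero_neg {k : ℝ} (hk : k ≤ 1 / 2) :
    poa affineGames (affineMechanism 0 (-k)) = ENNReal.ofReal (pigouRatio (1 / (1 - k))) :=
  poa_affineMechanism (one_div_one_sub_mem_Ioc hk) (by linarith)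
    (by rw [← sub_eq_add_neg, div_mul_cancel₀ _ (by linarith), add_zero])

/-- The mechanisms on `𝒢`, possibly depending on the network, whose incentives lie between a
subsidy bounded by `α` and a toll bounded by `β`. -/
def incentivesWithin (𝒢 : Set RoutingProblem) (α β : ℝ) : Set Mechanism :=
  {T | ∀ G ∈ 𝒢, ∀ (e : G.E) (x : ℝ≥0), T G e x ∈ Set.Icc (-(α * G.lat e x)) (β * G.lat e x)}

theorem pigouRatio_le_poa_of_mem_incentivesWithin {α β γ : ℝ} (hγ : γ ∈ Set.Ioc 0 2)
    (hαβ : 1 + β ≤ γ * (1 - α)) {T : Mechanism} (hT : T ∈ incentivesWithin affineGames α β) :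
    ENNReal.ofReal (pigouRatio γ) ≤ poa affineGames T := by
  lift γ to ℝ≥0 using hγ.1.le
  have hlinear := (hT _ (pigou_mem_affineGames γ) false 1).2
  have hconstant := (hT _ (pigou_mem_affineGames γ) true 0).1
  simp only [pigouLatency, id_eq, NNReal.coe_one] at hlinear hconstant
  exact pigouRatio_le_poa hγ (by linarith)

theorem mem_boundedTolls_iff {𝒢 : Set RoutingProblem} {β : ℝ} {T : Mechanism} :
    T ∈ boundedTolls 𝒢 β ↔ IsNetworkAgnostic 𝒢 T ∧
      (∀ G ∈ 𝒢, ∀ e : G.E, IsIntegrableIncentive (T G e)) ∧ T ∈ incentivesWithin 𝒢 0 β := by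
  simp [boundedTolls, incentivesWithin, forall_and]

theorem mem_boundedSubsidies_iff {𝒢 : Set RoutingProblem} {β : ℝ} {T : Mechanism} :
    T ∈ boundedSubsidies 𝒢 β ↔ IsNetworkAgnostic 𝒢 T ∧
      (∀ G ∈ 𝒢, ∀ e : G.E, IsIntegrableIncentive (T G e)) ∧ T ∈ incentivesWithin 𝒢 β 0 := by
  simp [boundedSubsidies, incentivesWithin, forall_and]

theorem isNetworkAgnostic_affineMechanism (𝒢 : Set RoutingProblem) (k₁ k₂ : ℝ) :
    IsNetworkAgnostic 𝒢 (affineMechanism k₁ k₂) := by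
  intro G _ G' _ e e' h
  funext x
  simp only [affineMechanism, h]

theorem isIntegrableIncentive_affineMechanism (k₁ k₂ : ℝ) {G : RoutingProblem} (e : G.E) :
    IsIntegrableIncentive (affineMechanism k₁ k₂ G e) := by
  have hmono : Monotone fun x : ℝ => (G.lat e x.toNNReal : ℝ) := fun _ _ h =>
    NNReal.coe_le_coe.2 (G.lat_mono e (Real.toNNReal_le_toNNReal h))
  have hlat : MeasureTheory.LocallyIntegrable (fun x : ℝ => (G.lat e x.toNNReal : ℝ)) :=
    hmono.locallyIntegrable
  exact (((hlat.sub (MeasureTheory.locallyIntegrable_const _)).smul k₁).add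
    (MeasureTheory.locallyIntegrable_const _)).locallyIntegrableOn _

theorem affineMechanism_mem_incentivesWithin (𝒢 : Set RoutingProblem) {α β k₁ k₂ : ℝ}
    (hk₁ : k₁ ∈ Set.Icc (-α) β) (hk₂ : k₂ ∈ Set.Icc (-α) β) :
    affineMechanism k₁ k₂ ∈ incentivesWithin 𝒢 α β := by
  intro G _ e x
  have hincr : (0 : ℝ) ≤ G.lat e x - G.lat e 0 :=
    sub_nonneg.2 (NNReal.coe_le_coe.2 (G.lat_mono e zero_le))
  have hlow := add_le_add (mul_le_mul_of_nonneg_right hk₁.1 hincr)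
    (mul_le_mul_of_nonneg_right hk₂.1 (G.lat e 0).coe_nonneg)
  have hhigh := add_le_add (mul_le_mul_of_nonneg_right hk₁.2 hincr)
    (mul_le_mul_of_nonneg_right hk₂.2 (G.lat e 0).coe_nonneg)
  constructor <;> simp only [affineMechanism] <;> linarith

theorem affineMechanism_mem_boundedTolls (𝒢 : Set RoutingProblem) {k β : ℝ} (hk : 0 ≤ k)
    (hkβ : k ≤ β) : affineMechanism k 0 ∈ boundedTolls 𝒢 β :=
  mem_boundedTolls_iff.2 ⟨isNetworkAgnostic_affineMechanism _ _ _,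
    fun _ _ => isIntegrableIncentive_affineMechanism _ _,
    affineMechanism_mem_incentivesWithin _ (by simp [hk, hkβ]) (by simp [hk.trans hkβ])⟩

theorem affineMechanism_mem_boundedSubsidies (𝒢 : Set RoutingProblem) {k β : ℝ} (hk : 0 ≤ k)
    (hkβ : k ≤ β) : affineMechanism 0 (-k) ∈ boundedSubsidies 𝒢 β :=
  mem_boundedSubsidies_iff.2 ⟨isNetworkAgnostic_affineMechanism _ _ _,
    fun _ _ => isIntegrableIncentive_affineMechanism _ _,
    affineMechanism_mem_incentivesWithin _ (by simp [hk.trans hkβ]) (by simp [hk, hkβ])⟩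

theorem isOptimal_affineMechanism_of_exhausts_bounds {S : Set Mechanism} {α β γ : ℝ}
    (hγ : γ ∈ Set.Ioc 0 2) (hα : α < 1) (hαβ : 1 + β = γ * (1 - α))
    (hmem : affineMechanism β (-α) ∈ S) (hS : S ⊆ incentivesWithin affineGames α β) :
    IsOptimal affineGames S (affineMechanism β (-α)) :=
  ⟨hmem, fun _ hT => (poa_affineMechanism_le hγ (neg_lt_neg hα) hαβ).trans
    (pigouRatio_le_poa_of_mem_incentivesWithin hγ hαβ.le (hS hT))⟩

theorem isOptimal_of_poa_eq_one {S : Set Mechanism} {T : Mechanism} (hT : T ∈ S)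
    (h : poa affineGames T = 1) : IsOptimal affineGames S T :=
  ⟨hT, fun T' _ => h.trans_le (one_le_poa_affineGames T')⟩

section BoundedIncentives

variable {β : ℝ} {S : Set Mechanism}

theorem isOptimal_toll (hβ : 0 ≤ β) (hS : boundedTolls affineGames β ⊆ S)
    (hS' : S ⊆ incentivesWithin affineGames 0 β) :
    IsOptimal affineGames S (if β < 1 then affineMechanism β 0 else affineMechanism 1 0) := by
  split_ifs with h
  · have hmem := hS (affineMechanism_mem_boundedTolls _ hβ le_rfl)
    rw [← neg_zero] at hmem ⊢
    exact isOptimal_affineMechanism_of_exhausts_bounds (γ := 1 + β) ⟨by linarith, by linarith⟩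
      one_pos (by ring) hmem hS'
  · exact isOptimal_of_poa_eq_one
      (hS (affineMechanism_mem_boundedTolls _ zero_le_one (not_lt.1 h)))
      (poa_affineMechanism_eq_one (by norm_num) (by norm_num))

theorem poa_optimal_toll (hβ : 0 ≤ β) :
    poa affineGames (if β < 1 then affineMechanism β 0 else affineMechanism 1 0) =
      if β < 1 then ENNReal.ofReal (4 / (3 + 2 * β - β ^ 2)) else 1 := by
  split_ifs with h
  · rw [poa_affineMechanism (γ := 1 + β) ⟨by linarith, by linarith⟩ (by norm_num) (by ring),
      pigouRatio_one_add]
  · exact poa_affineMechanism_eq_one (by norm_num) (by norm_num)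

theorem isOptimal_subsidy (hβ : 0 ≤ β) (hS : boundedSubsidies affineGames β ⊆ S)
    (hS' : S ⊆ incentivesWithin affineGames β 0) :
    IsOptimal affineGames S
      (if β < 1 / 2 then affineMechanism 0 (-β) else affineMechanism 0 (-(1 / 2))) := by
  split_ifs with h
  · exact isOptimal_affineMechanism_of_exhausts_bounds (one_div_one_sub_mem_Ioc h.le) (by linarith)
      (by rw [div_mul_cancel₀ _ (by linarith), add_zero])
      (hS (affineMechanism_mem_boundedSubsidies _ hβ le_rfl)) hS'
  · exact isOptimal_of_poa_eq_one
      (hS (affineMechanism_mem_boundedSubsidies _ (by norm_num) (not_lt.1 h)))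
      (poa_affineMechanism_eq_one (by norm_num) (by norm_num))

theorem poa_optimal_subsidy :
    poa affineGames
        (if β < 1 / 2 then affineMechanism 0 (-β) else affineMechanism 0 (-(1 / 2))) =
      if β < 1 / 2 then
        ENNReal.ofReal (4 / (3 + 2 * (1 / (1 - β) - 1) - (1 / (1 - β) - 1) ^ 2))
      else 1 := by
  split_ifs with h
  · rw [← pigouRatio_one_add, add_sub_cancel, poa_affineMechanism_zero_neg h.le]
  · exact poa_affineMechanism_eq_one (by norm_num) (by norm_num)

theorem poa_optimal_subsidy_lt_poa_toll (hβ₀ : 0 < β) (hβ₁ : β < 1)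
    (hS : boundedSubsidies affineGames β ⊆ S) {Tplus Tminus : Mechanism}
    (hplus : Tplus ∈ incentivesWithin affineGames 0 β)
    (hminus : IsOptimal affineGames S Tminus) :
    poa affineGames Tminus < poa affineGames Tplus := by
  calc poa affineGames Tminus
      ≤ poa affineGames (affineMechanism 0 (-min β (1 / 2))) :=
        hminus.2 _ (hS (affineMechanism_mem_boundedSubsidies _ (by positivity) (min_le_left _ _)))
    _ = ENNReal.ofReal (pigouRatio (1 / (1 - min β (1 / 2)))) :=
        poa_affineMechanism_zero_neg (min_le_right _ _)
    _ < ENNReal.ofReal (pigouRatio (1 + β)) := by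
        have hlt := pigouRatio_one_div_one_sub_min_lt hβ₀ hβ₁
        have hone := one_le_pigouRatio (γ := 1 + β) ⟨by linarith, by linarith⟩
        exact (ENNReal.ofReal_lt_ofReal_iff (by linarith)).2 hlt
    _ ≤ poa affineGames Tplus :=
        pigouRatio_le_poa_of_mem_incentivesWithin ⟨by linarith, by linarith⟩ (by linarith) hplus

end BoundedIncentives

end CongestionGame

open CongestionGame in
theorem proposition1_general {β : ℝ} (hβ : 0 ≤ β) {Splus Sminus : Set Mechanism}
    (hplus : boundedTolls affineGames β ⊆ Splus)
    (hplus' : Splus ⊆ incentivesWithin affineGames 0 β)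
    (hminus : boundedSubsidies affineGames β ⊆ Sminus)
    (hminus' : Sminus ⊆ incentivesWithin affineGames β 0) :
    (IsOptimal affineGames Splus
        (if β < 1 then affineMechanism β 0 else affineMechanism 1 0) ∧
      poa affineGames (if β < 1 then affineMechanism β 0 else affineMechanism 1 0) =
        if β < 1 then ENNReal.ofReal (4 / (3 + 2 * β - β ^ 2)) else 1) ∧
    (IsOptimal affineGames Sminus
        (if β < 1 / 2 then affineMechanism 0 (-β) else affineMechanism 0 (-(1 / 2))) ∧
      poa affineGames
          (if β < 1 / 2 then affineMechanism 0 (-β) else affineMechanism 0 (-(1 / 2))) =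
        if β < 1 / 2 then
          ENNReal.ofReal
            (4 / (3 + 2 * (1 / (1 - β) - 1) - (1 / (1 - β) - 1) ^ 2))
        else 1) ∧
    (0 < β → β < 1 → ∀ Tplus ∈ Splus, ∀ Tminus, IsOptimal affineGames Sminus Tminus →
      poa affineGames Tminus < poa affineGames Tplus) :=
  ⟨⟨isOptimal_toll hβ hplus hplus', poa_optimal_toll hβ⟩,
    ⟨isOptimal_subsidy hβ hminus hminus', poa_optimal_subsidy⟩,
    fun hβ₀ hβ₁ _ hTplus _ hTminus =>
      poa_optimal_subsidy_lt_poa_toll hβ₀ hβ₁ hminus (hplus' hTplus) hTminus⟩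

open CongestionGame in
theorem proposition1 (β : ℝ) (hβ : 0 ≤ β) :
    -- the optimal bounded toll and its price of anarchy
    (IsOptimal affineGames (boundedTolls affineGames β)
        (if β < 1 then affineMechanism β 0 else affineMechanism 1 0) ∧
      poa affineGames (if β < 1 then affineMechanism β 0 else affineMechanism 1 0) =
        if β < 1 then ENNReal.ofReal (4 / (3 + 2 * β - β ^ 2)) else 1) ∧
    -- the optimal bounded subsidy and its price of anarchy
    (IsOptimal affineGames (boundedSubsidies affineGames β)
        (if β < 1 / 2 then affineMechanism 0 (-β) else affineMechanism 0 (-(1 / 2))) ∧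
      poa affineGames
          (if β < 1 / 2 then affineMechanism 0 (-β) else affineMechanism 0 (-(1 / 2))) =
        if β < 1 / 2 then
          ENNReal.ofReal
            (4 / (3 + 2 * (1 / (1 - β) - 1) - (1 / (1 - β) - 1) ^ 2))
        else 1) ∧
    -- optimal subsidies strictly outperform optimal tolls
    (0 < β → β < 1 → ∀ Tplus Tminus : Mechanism,
      IsOptimal affineGames (boundedTolls affineGames β) Tplus →
      IsOptimal affineGames (boundedSubsidies affineGames β) Tminus →
      poa affineGames Tminus < poa affineGames Tplus) := by
  obtain ⟨htoll, hsubsidy, hlt⟩ := proposition1_general hβ subset_rfl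
    (fun _ h => (mem_boundedTolls_iff.1 h).2.2) subset_rfl
    fun _ h => (mem_boundedSubsidies_iff.1 h).2.2
  exact ⟨htoll, hsubsidy, fun hβ₀ hβ₁ Tplus Tminus hplus => hlt hβ₀ hβ₁ Tplus hplus.1 Tminus⟩
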